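/- Let $C(a,b)$ denote the binomial coefficient, equal to $0$ unless $0\le b\le a$. A composition of $m$ into $h$ parts is an ordered $h$-tuple of positive integers with sum $m$, drawn as a tableau whose rows have these lengths; deleting its first $r$ columns means shortening each part by $r$ and discarding the rows that become empty, and the dimension of the result is its number of parts. For $s\ge 0$, given integers $f_0=j,f_1,\dots,f_s,f_{s+1}=k$, put $g=i-j-f_1-\dots-f_s$ and $$\bar c^{(s)i}_{j,f_1,\dots,f_s,k}=\prod_{t=0}^{s}C(f_t,f_{t+1})\cdot\begin{cases}\frac{k}{g}C(g,k)&k\ne0,\ g\ne 0,\\ 1&k=0,\ g=0,\\ 0&\text{otherwise,}\end{cases}\qquad c^{(s)i}_{jk}=\sum_{j\ge f_1\ge\dots\ge f_s\ge k}\bar c^{(s)i}_{j,f_1,\dots,f_s,k}.$$ **(A)** Among all compositions of $m$ into $h$ parts, the number of those that have dimension $\ell$ after their first $s+1$ columns are deleted is $c^{(s)m}_{h\ell}$. A dimension $\ell\ge1$ occurs iff $\ell\le h$ and $h+(s+1)\ell\le m$; the dimension $0$ occurs iff $h\le m\le (s+1)h$. Moreover, with $P_s(j,k;f)=\prod_{t=1}^{s}C(j-f_{t+1},f_t-f_{t+1})$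 (where $f_{s+1}=k$), for $k\ge1$ $$c^{(s)i}_{jk}=C(j,k)\sum_{j\ge f_1\ge\dots\ge f_s\ge k}P_s(j,k;f)\,C(i-j-f_1-\dots-f_s-1,\,k-1),$$ and $c^{(s)i}_{j0}=\sum P_s(j,0;f)$ over $j\ge f_1\ge\dots\ge f_s\ge0$ with $j+f_1+\dots+f_s=i$ if $i\le(s+1)j$, and $c^{(s)i}_{j0}=0$ otherwise. **(B)** Let $n\ge1$, $N=m+n$. Consider the binary sequences with $m$ zeros and $n$ ones, read cyclically, occurrences of a string being counted by starting place. Let $T^{mn}_{\ell}(U)$ be the number of them in which $U$ occurs exactly $\ell$ times, and similarly for several strings. Then, for $h\ge1$, $$T^{mn}_{h,f_1,\dots,f_s,\ell}(01;001;\dots;0^{s+2}1)=\frac Nh\,\bar c^{(s)m}_{h,f_1,\dots,f_s,\ell}\,C(n-1,h-1).$$ In particular, for $\ell\ge1$, $$T^{mn}_{h\ell'\ell}(01;001;0001)=\frac Nn C(h,\ell)C(h-\ell,\ell'-\ell)C(m-h-\ell'-1,\ell-1)C(n,h)=\frac Nn C(n,\ell)C(n-\ell,\ell'-\ell)C(n-\ell',h-\ell')C(m-h-\ell'-1,\ell-1),$$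 and for $h\le m\le 2h$, $T^{mn}_{h,m-h,0}(01;001;0001)=\frac Nn C(n,m-h)C(n-m+h,2h-m)$. **(C)** Let $n\ge1$, $N=m+n$. For all $\ell\ge0$, $T^{mn}_\ell(0^{s+2}1)=\frac Nn\sum_{h=0}^{n}c^{(s)m}_{h\ell}C(n,h)$. For $\ell\ge1$, $$T^{mn}_\ell(0^{s+2}1)=\frac Nn C(n,\ell)\sum_{h=\ell}^{\min(m-(s+1)\ell,\,n)}\ \sum_{h\ge f_1\ge\dots\ge f_s\ge\ell}P_s(h,\ell;f)\,C(n-\ell,h-\ell)\,C(m-h-f_1-\dots-f_s-1,\,\ell-1),$$ and $T^{mn}_0(0^{s+2}1)=\frac Nn\sum_{h=0}^{\min(m,n)}\sum P_s(h,0;f)\,C(n,h)$, the inner sum over $h\ge f_1\ge\dots\ge f_s\ge0$ with $h+f_1+\dots+f_s=m$. In particular $$T^{mn}_\ell(0001)=\frac Nn C(n,\ell)\sum_{h=\ell}^{\min(m-2\ell,n)}\sum_{\ell'=\ell}^{h}C(n-\ell',h-\ell')C(n-\ell,\ell'-\ell)C(m-h-\ell'-1,\ell-1)\quad(\ell\ge1),$$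 $$T^{mn}_0(0001)=\frac Nn\sum_{h=\lceil m/2\rceil}^{\min(n,m)}C(n,m-h)C(n-m+h,2h-m).$$ **(D)** (Cyclic Kaplansky lemma.) For $n\ge1$, $N=m+n$ one has $T^{mn}_n(0^{s+2}1)=\frac Nn C(m-n-sn-1,n-1)$, and with $p=s+2$, if $pn<N$, this equals $\frac{N}{N-pn}C(N-pn,n)$. For all $N,n,p\ge0$ with $pn<N$, the number of cyclic sequences of length $N$ with $n$ ones in which each pair of ones is separated (in both directions around the cycle) by at least $p$ zeros is $\frac{N}{N-pn}C(N-pn,n)$. -/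

import Mathlib

open Finset

namespace BinSeq

/-- The binomial coefficient `C(a, b)` for integers `a`, `b`, equal to `0` unless `0 ≤ b ≤ a`. -/
def zchoose (a b : ℤ) : ℕ :=
  if 0 ≤ b ∧ b ≤ a then a.toNat.choose b.toNat else 0

/-- The composition (Young-De Moivre tableau, one row for each part) that remains when the first
`r` columns of a composition are deleted: each part is shortened by `r`, and the rows that
become empty disappear. Its number of parts is its dimension `Composition.length`. -/
def deleteColumns (r : ℕ) {m : ℕ} (a : Composition m) :
    Composition ((a.blocks.map (fun x => x - r)).sum) where
  blocks := (a.blocks.map (fun x => x - r)).filter (fun x => 0 < x)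
  blocks_pos := by
    intro i hi
    simpa using (List.mem_filter.mp hi).2
  blocks_sum := by
    generalize a.blocks.map (fun x => x - r) = L
    induction L with
    | nil => simp
    | cons x L ih =>
      by_cases hx : 0 < x
      · simp [hx] at ih ⊢
        exact ih
      · have h0 : x = 0 := by omega
        subst h0
        simpa using ih

/-- The sequence `j, f₁, f₂, …, f_s, k`. -/
def ext {s : ℕ} (j k : ℕ) (f : Fin s → ℕ) : Fin (s + 2) → ℕ :=
  Fin.cons (α := fun _ => ℕ) j (Fin.snoc (α := fun _ => ℕ) f k)

/-- All `(f₁, …, f_s)` with `j ≥ f₁ ≥ f₂ ≥ ⋯ ≥ f_s ≥ k`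
(for `s = 0`, the empty tuple if `j ≥ k`, and nothing otherwise). -/
def chains (s j k : ℕ) : Finset (Fin s → ℕ) :=
  {f ∈ Fintype.piFinset (fun _ : Fin s => range (j + 1)) |
    ∀ t : Fin (s + 1), ext j k f t.succ ≤ ext j k f t.castSucc}

/-- The summand of `c^{(s)i}_{jk}` that belongs to the indices `f₁, …, f_s`. With
`g = i - j - f₁ - ⋯ - f_s` it is
`(k / g) C(j, f₁) C(f₁, f₂) ⋯ C(f_{s-1}, f_s) C(f_s, k) C(g, k)` for `k ≠ 0`, and
`C(j, f₁) C(f₁, f₂) ⋯ C(f_{s-1}, f_s)` if `g = 0`, and `0` otherwise, for `k = 0`. -/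
def cBar (s i j : ℕ) (f : Fin s → ℕ) (k : ℕ) : ℚ :=
  let g : ℤ := (i : ℤ) - j - ∑ t, (f t : ℤ)
  (∏ t : Fin (s + 1), ((ext j k f t.castSucc).choose (ext j k f t.succ) : ℚ)) *
    (if k = 0 then (if g = 0 then 1 else 0) else (k : ℚ) / (g : ℚ) * (zchoose g k : ℚ))

/-- The number `c^{(s)i}_{jk}`. -/
def c (s i j k : ℕ) : ℚ := ∑ f ∈ chains s j k, cBar s i j f k

/-- The product `C(j - f₂, f₁ - f₂) C(j - f₃, f₂ - f₃) ⋯ C(j - f_s, f_{s-1} - f_s)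
C(j - k, f_s - k)`, equal to `1` for `s = 0`. -/
def nested {s : ℕ} (j k : ℕ) (f : Fin s → ℕ) : ℕ :=
  ∏ t : Fin s, (j - ext j k f t.succ.succ).choose
    (ext j k f t.succ.castSucc - ext j k f t.succ.succ)

/-- The number of ones of a binary sequence of length `N`. -/
def ones {N : ℕ} (S : Fin N → Fin 2) : ℕ := #{i | S i = 1}

/-- The number of occurrences of the string `U` in the sequence `S` read cyclically: the number
of starting places `i` for which the digits at `i, i + 1, …, i + |U| - 1` (modulo `N`) are those
of `U`. -/
def occ {N : ℕ} (U : List (Fin 2)) (S : Fin N → Fin 2) : ℕ :=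
  #{i : Fin N | ∀ t : Fin U.length, S ⟨(i.val + t.val) % N, Nat.mod_lt _ i.pos⟩ = U.get t}

/-- The string `00⋯01` with `a` zeros followed by a one. -/
def zerosOne (a : ℕ) : List (Fin 2) := List.replicate a 0 ++ [1]

/-- `T^{mn}_ℓ(U)`: the number of sequences with `m` zeros and `n` ones in which the string `U`
occurs, cyclically, exactly `ℓ` times. -/
def T (m n : ℕ) (U : List (Fin 2)) (ℓ : ℕ) : ℕ :=
  #{S : Fin (m + n) → Fin 2 | ones S = n ∧ occ U S = ℓ}

/-- The number of sequences with `m` zeros and `n` ones in which, for each `t = 0, …, s + 1`,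
the string of `t + 1` zeros followed by a one occurs, cyclically, exactly `v t` times. -/
def jointT (m n : ℕ) {s : ℕ} (v : Fin (s + 2) → ℕ) : ℕ :=
  #{S : Fin (m + n) → Fin 2 | ones S = n ∧ ∀ t : Fin (s + 2), occ (zerosOne (t.val + 1)) S = v t}

/-- In the cyclic sequence `S` each pair of ones is separated by at least `p` zeros: for distinct
places `i` and `j` that hold ones, at least `p` of the places `i, i + 1, …, j - 1` (modulo `N`),
passed on the way from `i` clockwise to `j`, hold zeros. -/
def Separated {N : ℕ} (p : ℕ) (S : Fin N → Fin 2) : Prop :=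
  ∀ i j : Fin N, S i = 1 → S j = 1 → i ≠ j →
    p ≤ #{t ∈ range ((j.val + N - i.val) % N) |
      S ⟨(i.val + t) % N, Nat.mod_lt _ i.pos⟩ = 0}

instance {N : ℕ} (p : ℕ) : DecidablePred (Separated (N := N) p) := fun S => by
  unfold Separated; infer_instance

/-- The number of cyclic sequences of length `N` with `n` ones, each pair of which is separated
by at least `p` zeros. -/
def kaplansky (N n p : ℕ) : ℕ :=
  #{S : Fin N → Fin 2 | ones S = n ∧ Separated p S}

end BinSeq

namespace BinSeq

/-! Everything reduces to counting tableaux by column heights. If exactly `v t` rows are longer than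
`t` for `t = 0, …, r`, choose the rows that reach the first column, among these the rows that reach
the second, and so on; the cells left over go freely to the `v r` rows that reach the last
prescribed column. This gives a product of binomials times a multichoose number
(`card_piAntidiag_columns`). By stars and bars and absorption, that last factor is `C(g - 1, k - 1)
= (k / g) C(g, k)` for `k ≥ 1`; for `k = 0` it only says that nothing is left over.

For cyclic sequences, mark one of the `n` ones and rotate it to the last place: `n` times the number
of sequences is `N` times the number of those ending in a one (`mul_card_ones`). The latter are
concatenations of blocks `0⋯01`, that is, compositions of `N` into `n` parts, and the string of `a`
zeros and a one occurs once for each part exceeding `a` (`occ_ofComposition`). The first column is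
the column of ones, so the counts of `01, 001, …` are the heights of the later columns.

Distributions of a single string arise by summing over the intermediate heights, which form a
decreasing chain. The second forms come from trinomial revision, and Kaplansky's lemma is the case
in which all heights equal `n`. -/

/-! ### Functions with prescribed column heights -/

/-- Peeling off the first column: on the support `A`, subtracting one lowers the sum by `a` and
shifts the level sets by one. The predicate `Q` carries the conditions on the later columns. -/
theorem card_piAntidiag_eq_sum_powersetCard {ι : Type*} [DecidableEq ι] (s : Finset ι) (m a : ℕ)
    (Q : (ℕ → ℕ) → Prop) [DecidablePred Q] :
    #{g ∈ piAntidiag s m | #{i ∈ s | 0 < g i} = a ∧ Q (fun t => #{i ∈ s | t + 1 < g i})} =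
      ∑ A ∈ powersetCard a s,
        if a ≤ m then #{g ∈ piAntidiag A (m - a) | Q (fun t => #{i ∈ A | t < g i})} else 0 := by
  classical
  rw [card_eq_sum_card_fiberwise (f := fun g : ι → ℕ => {i ∈ s | 0 < g i}) (t := powersetCard a s)]
  · refine sum_congr rfl fun A hA => ?_
    rw [mem_powersetCard] at hA
    obtain ⟨hAs, hAc⟩ := hA
    have key : ∀ g : ι → ℕ, (∀ i, g i ≠ 0 → i ∈ s) → {i ∈ s | 0 < g i} = A →
        ∑ i ∈ s, g i = a + ∑ i ∈ A, (g i - 1) ∧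
          ∀ t, {i ∈ s | t + 1 < g i} = {i ∈ A | t < g i - 1} := by
      intro g hg h
      constructor
      · rw [← hAc, card_eq_sum_ones, ← sum_add_distrib, ← h, sum_filter]
        refine sum_congr rfl fun i _ => ?_
        split_ifs <;> omega
      · intro t
        rw [← h, filter_filter]
        exact filter_congr fun i _ => by omega
    split_ifs with ham
    · refine card_bij' (fun g _ i => g i - 1) (fun g _ i => if i ∈ A then g i + 1 else 0) ?_ ?_ ?_ ?_
      · intro g hg
        simp only [mem_filter, mem_piAntidiag] at hg ⊢
        obtain ⟨⟨⟨hsum, hsupp⟩, hca, hQ⟩, hA⟩ := hg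
        obtain ⟨h1, h2⟩ := key g hsupp hA
        refine ⟨⟨by rw [hsum] at h1; omega, fun i hi => ?_⟩, by simpa only [h2] using hQ⟩
        rw [← hA, mem_filter]
        exact ⟨hsupp i (by omega), by omega⟩
      · intro g hg
        simp only [mem_filter, mem_piAntidiag] at hg ⊢
        obtain ⟨⟨hsum, hsupp⟩, hQ⟩ := hg
        have hsupp' : ∀ i, (if i ∈ A then g i + 1 else 0) ≠ 0 → i ∈ s := fun i hi => by
          by_contra h
          exact hi (if_neg fun h' => h (hAs h'))
        have hA : {i ∈ s | 0 < if i ∈ A then g i + 1 else 0} = A := by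
          ext i
          rw [mem_filter]
          refine ⟨fun h => ?_, fun h => ⟨hAs h, by simp [h]⟩⟩
          by_contra h'
          simp [h'] at h
        obtain ⟨h1, h2⟩ := key _ hsupp' hA
        have h3 : ∀ i ∈ A, (if i ∈ A then g i + 1 else 0) - 1 = g i := fun i hi => by simp [hi]
        rw [sum_congr rfl h3] at h1
        refine ⟨⟨⟨by omega, hsupp'⟩, by rw [hA, hAc], ?_⟩, hA⟩
        simp only [h2]
        have h4 : ∀ t, {i ∈ A | t < (if i ∈ A then g i + 1 else 0) - 1} = {i ∈ A | t < g i} :=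
          fun t => filter_congr fun i hi => by rw [h3 i hi]
        simpa only [h4] using hQ
      · intro g hg
        simp only [mem_filter, mem_piAntidiag] at hg
        obtain ⟨⟨⟨hsum, hsupp⟩, hca, hQ⟩, hA⟩ := hg
        funext i
        by_cases hi : i ∈ A
        · rw [if_pos hi]
          rw [← hA, mem_filter] at hi
          exact Nat.sub_add_cancel hi.2
        · rw [if_neg hi]
          by_contra h
          exact hi (hA ▸ mem_filter.2 ⟨hsupp i (Ne.symm h), by omega⟩)
      · intro g hg
        simp only [mem_filter, mem_piAntidiag] at hg
        funext i
        by_cases hi : i ∈ A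
        · simp [hi]
        · simp only [if_neg hi]
          by_contra h
          exact hi (hg.1.2 i (by omega))
    · rw [card_eq_zero, filter_eq_empty_iff]
      intro g hg hA
      simp only [mem_filter, mem_piAntidiag] at hg
      have := (key g hg.1.2 hA).1
      rw [hg.1.1] at this
      omega
  · intro g hg
    simp only [coe_filter, Set.mem_ofPred_eq] at hg
    exact mem_powersetCard.2 ⟨filter_subset _ _, hg.2.1⟩

theorem card_piAntidiag_eq_multichoose {ι : Type*} [DecidableEq ι] (s : Finset ι) (m : ℕ) :
    #(piAntidiag s m) = Nat.multichoose #s m := by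
  induction s using Finset.cons_induction generalizing m with
  | empty => cases m <;> simp
  | cons a s ha ih =>
    rw [piAntidiag_cons, card_disjiUnion, card_cons]
    simp only [card_map, ih]
    rw [Nat.sum_antidiagonal_eq_sum_range_succ (fun _ j => Nat.multichoose #s j) m,
      ← Finset.sum_range_reflect]
    rw [sum_congr rfl (g := fun j => Nat.multichoose #s j)
      fun j hj => by congr 1; have := mem_range.1 hj; omega]
    -- The partial sums of multichoose numbers collapse by the Pascal-type recurrence.
    induction m with
    | zero => simp
    | succ m ihm => rw [sum_range_succ, ihm, Nat.multichoose_succ_succ, add_comm]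

/-- The number of functions on `s` with sum `m` for which exactly `v t` of the values
exceed `t`, for each `t`. -/
theorem card_piAntidiag_columns {ι : Type*} [DecidableEq ι] (r : ℕ) (v : Fin (r + 1) → ℕ)
    (s : Finset ι) (m : ℕ) :
    #{g ∈ piAntidiag s m | ∀ t : Fin (r + 1), #{i ∈ s | t.val < g i} = v t} =
      (#s).choose (v 0) * (∏ t : Fin r, (v t.castSucc).choose (v t.succ)) *
        if ∑ t, v t ≤ m then Nat.multichoose (v (Fin.last r)) (m - ∑ t, v t) else 0 := by
  induction r generalizing s m with
  | zero =>
    have := card_piAntidiag_eq_sum_powersetCard s m (v 0) (fun _ => True)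
    simp only [and_true, filter_true, card_piAntidiag_eq_multichoose] at this
    rw [filter_congr fun g _ => Fin.forall_fin_one (p := fun t => #{i ∈ s | t.val < g i} = v t)]
    simp only [Fin.val_zero]
    rw [this, sum_congr rfl (g := fun _ => if v 0 ≤ m then Nat.multichoose (v 0) (m - v 0) else 0)
      (fun A hA => by rw [(mem_powersetCard.1 hA).2])]
    simp
  | succ r ih =>
    have := card_piAntidiag_eq_sum_powersetCard s m (v 0)
      (fun u => ∀ t : Fin (r + 1), u t = v t.succ)
    rw [filter_congr fun g _ =>
      Fin.forall_fin_succ (P := fun t : Fin (r + 1 + 1) => #{i ∈ s | t.val < g i} = v t)]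
    refine Eq.trans ?_ (this.trans ?_)
    · simp only [Fin.val_succ]
      rfl
    · simp only [ih (fun t => v t.succ)]
      rw [sum_congr rfl (g := fun _ => (∏ t : Fin (r + 1), (v t.castSucc).choose (v t.succ)) *
        if ∑ t, v t ≤ m then Nat.multichoose (v (Fin.last (r + 1))) (m - ∑ t, v t) else 0)]
      · simp [mul_assoc]
      · intro A hA
        rw [(mem_powersetCard.1 hA).2, Fin.sum_univ_succ (n := r + 1), Fin.prod_univ_succ (n := r)]
        simp only [Fin.succ_zero_eq_one, Fin.castSucc_zero, Fin.succ_castSucc, Fin.succ_last]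
        by_cases h : v 0 ≤ m
        · rw [if_pos h]
          congr 1
          rw [Nat.sub_sub]
          exact if_congr (by omega) rfl rfl
        · rw [if_neg h, if_neg (by omega), mul_zero]

/-! ### Compositions and deletion of columns -/

theorem countP_ofFn {n : ℕ} (f : Fin n → ℕ) (p : ℕ → Prop) [DecidablePred p] :
    (List.ofFn f).countP (fun x => p x) = #{i | p (f i)} := by
  rw [← Multiset.coe_countP, ← Fin.univ_val_map, Multiset.countP_map]
  rfl

theorem countP_blocks {M : ℕ} (c : Composition M) (a : ℕ) :
    c.blocks.countP (fun x => a < x) = #{k | a < c.blocksFun k} := by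
  rw [← c.ofFn_blocksFun, countP_ofFn]

/-- Compositions with a given number of parts are positive functions on `Fin n`. -/
theorem card_composition_eq (M n : ℕ) (P : (ℕ → ℕ) → Prop) [DecidablePred P] :
    #{c : Composition M | c.length = n ∧ P (fun a => c.blocks.countP (fun x => a < x))} =
      #{f ∈ piAntidiag (univ : Finset (Fin n)) M |
        #{i | 0 < f i} = n ∧ P (fun a => #{i | a < f i})} := by
  symm
  have pos : ∀ f : Fin n → ℕ, #{i | 0 < f i} = n → ∀ i, 0 < f i := by
    intro f hf i
    have := (card_filter_eq_iff (s := (univ : Finset (Fin n))) (p := fun i => 0 < f i)).1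
      (by rw [hf]; simp)
    exact this i (mem_univ i)
  refine card_bij (fun f hf => ⟨List.ofFn f, ?_, ?_⟩) ?_ ?_ ?_
  · intro i hi
    obtain ⟨k, rfl⟩ := (List.mem_ofFn' f i).1 hi
    exact pos f (mem_filter.1 hf).2.1 k
  · rw [List.sum_ofFn]
    exact (mem_piAntidiag.1 (mem_filter.1 hf).1).1
  · intro f hf
    simp only [mem_filter, mem_univ, true_and, Composition.length, List.length_ofFn, countP_ofFn]
    exact (mem_filter.1 hf).2.2
  · intro f hf g hg h
    exact List.ofFn_injective (congrArg Composition.blocks h)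
  · intro c hc
    simp only [mem_filter, mem_univ, true_and] at hc
    obtain ⟨rfl, hP⟩ := hc
    refine ⟨c.blocksFun, ?_, ?_⟩
    · simp only [mem_filter, mem_piAntidiag, mem_univ, implies_true, and_true]
      refine ⟨c.sum_blocksFun, ?_, ?_⟩
      · rw [filter_true_of_mem (p := fun i => 0 < c.blocksFun i) fun i _ => c.one_le_blocksFun i]
        simp
      · simpa only [countP_blocks] using hP
    · ext1
      exact c.ofFn_blocksFun

theorem length_deleteColumns {m : ℕ} (r : ℕ) (a : Composition m) :
    (deleteColumns r a).length = a.blocks.countP (fun x => r < x) := by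
  rw [deleteColumns, Composition.length, ← List.countP_eq_length_filter, List.countP_map]
  refine List.countP_congr fun x _ => ?_
  simp

/-- Every part contributes at least one, and a part exceeding `r` contributes `r` more. -/
theorem length_add_mul_countP_le_sum (L : List ℕ) (r : ℕ) (hL : ∀ x ∈ L, 0 < x) :
    L.length + r * L.countP (fun x => r < x) ≤ L.sum := by
  induction L with
  | nil => simp
  | cons x L ih =>
    have := ih fun y hy => hL y (List.mem_cons_of_mem _ hy)
    have hx := hL x List.mem_cons_self
    rw [List.countP_cons]
    simp only [List.length_cons, List.sum_cons]
    split_ifs with h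
    · have h' : r < x := by simpa using h
      rw [mul_add]
      omega
    · rw [add_zero]
      omega

theorem exists_list_length_sum (r h m : ℕ) (h1 : h ≤ m) (h2 : m ≤ (r + 1) * h) :
    ∃ L : List ℕ, L.length = h ∧ L.sum = m ∧ ∀ x ∈ L, 0 < x ∧ x ≤ r + 1 := by
  induction h generalizing m with
  | zero => exact ⟨[], by simp; omega⟩
  | succ h ih =>
    -- Greedy choice: the first part is as large as allowed while leaving at least `h` for the other
    -- `h` parts.
    obtain ⟨L, h3, h4, h5⟩ := ih (m - min (r + 1) (m - h)) (by omega)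
      (by rw [mul_add] at h2; have := Nat.le_mul_of_pos_left h (show 0 < r + 1 by omega); omega)
    refine ⟨min (r + 1) (m - h) :: L, by simp [h3], by simp only [List.sum_cons, h4]; omega, ?_⟩
    intro x hx
    rcases List.mem_cons.1 hx with rfl | hx
    · omega
    · exact h5 x hx

theorem exists_deleteColumns_length_pos (s m h l : ℕ) (hl : 1 ≤ l) :
    (∃ a : Composition m, a.length = h ∧ (deleteColumns (s + 1) a).length = l) ↔
      l ≤ h ∧ h + (s + 1) * l ≤ m := by
  constructor
  · rintro ⟨a, rfl, h2⟩
    rw [length_deleteColumns] at h2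
    have := length_add_mul_countP_le_sum a.blocks (s + 1) fun x hx => a.blocks_pos hx
    rw [a.blocks_sum, h2] at this
    exact ⟨h2 ▸ List.countP_le_length, this⟩
  · rintro ⟨h1, h2⟩
    obtain ⟨l, rfl⟩ := Nat.exists_eq_add_of_le' hl
    obtain ⟨d, rfl⟩ := Nat.exists_eq_add_of_le h1
    obtain ⟨e, rfl⟩ := Nat.exists_eq_add_of_le h2
    -- The parts that survive have the minimal length `s + 2`, except that one absorbs the excess
    -- `e`; the `d` others have length one.
    refine ⟨⟨(s + 2 + e) :: (List.replicate l (s + 2) ++ List.replicate d 1), ?_, ?_⟩, ?_, ?_⟩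
    · intro i hi
      simp only [List.mem_cons, List.mem_append, List.mem_replicate] at hi
      omega
    · simp
      ring
    · simp [Composition.length]
      ring
    · rw [length_deleteColumns]
      simp only [List.countP_cons, List.countP_append, List.countP_replicate]
      have : s + 1 < s + 2 + e := by omega
      simp [this]

theorem exists_deleteColumns_length_zero (s m h : ℕ) :
    (∃ a : Composition m, a.length = h ∧ (deleteColumns (s + 1) a).length = 0) ↔
      h ≤ m ∧ m ≤ (s + 1) * h := by
  simp only [length_deleteColumns, List.countP_eq_zero]
  constructor
  · rintro ⟨a, rfl, h2⟩
    refine ⟨a.length_le, ?_⟩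
    have := List.sum_le_card_nsmul a.blocks (s + 1) fun x hx => by simpa using h2 x hx
    rw [a.blocks_sum] at this
    rwa [mul_comm]
  · rintro ⟨h1, h2⟩
    obtain ⟨L, h3, h4, h5⟩ := exists_list_length_sum s h m h1 h2
    exact ⟨⟨L, fun hi => (h5 _ hi).1, h4⟩, h3, fun x hx => by simpa using (h5 x hx).2⟩

/-! ### Cyclic occurrences and rotation -/

theorem occ_zerosOne {N : ℕ} (a : ℕ) (S : Fin N → Fin 2) :
    occ (zerosOne a) S =
      #{i : Fin N | (∀ t < a, S ⟨(i.val + t) % N, Nat.mod_lt _ i.pos⟩ = 0) ∧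
        S ⟨(i.val + a) % N, Nat.mod_lt _ i.pos⟩ = 1} := by
  have hlen : (zerosOne a).length = a + 1 := by simp [zerosOne]
  have hget : ∀ t (h : t < (zerosOne a).length), (zerosOne a)[t] = if t < a then 0 else 1 := by
    intro t h
    by_cases ht : t < a
    · simp [zerosOne, ht]
    · simp [zerosOne, List.getElem_append, ht]
  refine congrArg card (filter_congr fun i _ => ?_)
  simp only [Fin.forall_iff, hlen, List.get_eq_getElem, hget]
  constructor
  · intro h
    refine ⟨fun t ht => by simpa [ht] using h t (by omega), by simpa using h a (by omega)⟩
  · rintro ⟨h1, h2⟩ t ht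
    by_cases hta : t < a
    · simpa [hta] using h1 t hta
    · obtain rfl : t = a := by omega
      simpa using h2

theorem mk_add_mod {N : ℕ} [NeZero N] (i : Fin N) (t : ℕ) :
    (⟨(i.val + t) % N, Nat.mod_lt _ i.pos⟩ : Fin N) = i + Fin.ofNat N t := by
  ext
  simp [Fin.val_add]

theorem occ_comp_add {N : ℕ} [NeZero N] (U : List (Fin 2)) (S : Fin N → Fin 2) (k : Fin N) :
    occ U (fun x => S (x + k)) = occ U S := by
  unfold occ
  refine card_equiv (Equiv.addRight k) fun i => ?_
  simp only [mem_filter, mem_univ, true_and, Equiv.coe_addRight, mk_add_mod]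
  simp only [add_right_comm]

theorem ones_comp_add {N : ℕ} [NeZero N] (S : Fin N → Fin 2) (k : Fin N) :
    ones (fun x => S (x + k)) = ones S :=
  card_equiv (Equiv.addRight k) fun i => by simp

/-- Marking one of the ones and rotating it to a given place. -/
theorem mul_card_ones {N n : ℕ} [NeZero N] (P : (Fin N → Fin 2) → Prop) [DecidablePred P]
    (hP : ∀ S k, P S → P (fun x => S (x + k))) (p : Fin N) :
    n * #{S : Fin N → Fin 2 | ones S = n ∧ P S} =
      N * #{S : Fin N → Fin 2 | S p = 1 ∧ ones S = n ∧ P S} := by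
  -- Double count the pairs of a sequence and a place of a one in it; rotation makes the count for
  -- each place equal to the count for `p`.
  have h := sum_card_bipartiteAbove_eq_sum_card_bipartiteBelow
    (s := ({S : Fin N → Fin 2 | ones S = n ∧ P S} : Finset _)) (t := univ)
    (fun (S : Fin N → Fin 2) (i : Fin N) => S i = 1)
  have h1 : ∀ S ∈ ({S : Fin N → Fin 2 | ones S = n ∧ P S} : Finset _),
      #(bipartiteAbove (fun (S : Fin N → Fin 2) (i : Fin N) => S i = 1) univ S) = n :=
    fun S hS => (mem_filter.1 hS).2.1
  have h2 : ∀ i ∈ (univ : Finset (Fin N)),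
      #(bipartiteBelow (fun (S : Fin N → Fin 2) (i : Fin N) => S i = 1)
        ({S : Fin N → Fin 2 | ones S = n ∧ P S} : Finset _) i) =
      #{S : Fin N → Fin 2 | S p = 1 ∧ ones S = n ∧ P S} := by
    intro i _
    refine card_bij' (fun S _ x => S (x + (i - p))) (fun S _ x => S (x + (p - i))) ?_ ?_ ?_ ?_
    · intro S hS
      simp only [mem_bipartiteBelow, mem_filter, mem_univ, true_and] at hS ⊢
      exact ⟨by simpa using hS.2, by rw [ones_comp_add]; exact hS.1.1, hP _ _ hS.1.2⟩
    · intro S hS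
      simp only [mem_bipartiteBelow, mem_filter, mem_univ, true_and] at hS ⊢
      exact ⟨⟨by rw [ones_comp_add]; exact hS.2.1, hP _ _ hS.2.2⟩, by simpa using hS.1⟩
    · intro S _
      funext x
      simp [add_assoc]
    · intro S _
      funext x
      simp [add_assoc]
  rw [sum_congr rfl h1, sum_congr rfl h2] at h
  simpa [mul_comm] using h

/-! ### Sequences ending in a one as compositions -/

/-- The sequence of the blocks `0⋯01` whose lengths are the parts of a composition. -/
def ofComposition {N : ℕ} (c : Composition N) : Fin N → Fin 2 :=
  fun p => if p.succ ∈ c.boundaries then 1 else 0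

theorem ofComposition_eq_one {N : ℕ} (c : Composition N) (p : Fin N) :
    ofComposition c p = 1 ↔ ∃ k : Fin c.length, c.sizeUpTo (k + 1) = p + 1 := by
  have : ofComposition c p = 1 ↔ p.succ ∈ c.boundaries := by
    unfold ofComposition
    split_ifs with h <;> simp [h]
  rw [this, Composition.boundaries, mem_map]
  simp only [mem_univ, true_and, Composition.boundary]
  constructor
  · rintro ⟨k, hk⟩
    have hk' : c.sizeUpTo k = p + 1 := congrArg Fin.val hk
    induction k using Fin.cases with
    | zero => simp at hk'
    | succ k => exact ⟨k, hk'⟩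
  · rintro ⟨k, hk⟩
    exact ⟨k.succ, Fin.ext hk⟩

theorem ofComposition_eq_zero {N : ℕ} (c : Composition N) (p : Fin N) :
    ofComposition c p = 0 ↔ ¬ ∃ k : Fin c.length, c.sizeUpTo (k + 1) = p + 1 := by
  rw [← ofComposition_eq_one]
  generalize ofComposition c p = x
  revert x
  decide

theorem ofComposition_injective (N : ℕ) :
    Function.Injective (ofComposition : Composition N → Fin N → Fin 2) := by
  intro c d h
  apply (compositionEquiv N).injective
  ext1
  change c.boundaries = d.boundaries
  ext x
  induction x using Fin.cases with
  | zero => exact iff_of_true c.toCompositionAsSet.zero_mem d.toCompositionAsSet.zero_mem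
  | succ p =>
    have := congrFun h p
    unfold ofComposition at this
    split_ifs at this <;> simp_all

/-- The boundaries are `0` and the right ends of the places holding ones; the one in the last place
supplies the boundary `N`. -/
theorem exists_ofComposition {N : ℕ} (S : Fin N → Fin 2) (p : Fin N) (hp : p.val + 1 = N)
    (hS : S p = 1) : ∃ c : Composition N, ofComposition c = S := by
  have hp' : p.succ = Fin.last N := Fin.ext hp
  let A : CompositionAsSet N :=
    ⟨insert 0 (({i | S i = 1} : Finset (Fin N)).map (Fin.succEmb N)), mem_insert_self _ _,
      mem_insert_of_mem (mem_map.2 ⟨p, by simp [hS], hp'⟩)⟩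
  refine ⟨A.toComposition, ?_⟩
  funext i
  have : i.succ ∈ A.boundaries ↔ S i = 1 := by simp [A, Fin.succ_ne_zero]
  rw [ofComposition, A.toComposition_boundaries]
  simp only [this]
  generalize S i = x
  revert x
  decide

theorem ofComposition_last {N : ℕ} (c : Composition N) (p : Fin N) (hp : p.val + 1 = N) :
    ofComposition c p = 1 := by
  have h0 : 0 < c.length := c.length_pos_iff.2 p.pos
  refine (ofComposition_eq_one c p).2 ⟨⟨c.length - 1, by omega⟩, ?_⟩
  rw [show c.length - 1 + 1 = c.length by omega, c.sizeUpTo_length, hp]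

/-- An occurrence must end at the one closing some block, and its `a` zeros fit exactly when that
block is longer than `a`. No occurrence wraps around, because the last digit is a one. -/
theorem occ_ofComposition {N : ℕ} (c : Composition N) (a : ℕ) :
    occ (zerosOne a) (ofComposition c) = c.blocks.countP (fun x => a < x) := by
  rw [occ_zerosOne, countP_blocks]
  symm
  have hs := c.sizeUpTo_succ'
  have hle := c.sizeUpTo_le
  refine card_bij (fun k hk => ⟨c.sizeUpTo (k + 1) - (a + 1), ?_⟩) ?_ ?_ ?_
  · have := hs k
    have := hle (k + 1)
    have := (mem_filter.1 hk).2
    omega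
  · intro k hk
    simp only [mem_filter, mem_univ, true_and] at hk ⊢
    have h1 := hs k
    have h2 := hle (k + 1)
    constructor
    · intro t ht
      rw [ofComposition_eq_zero]
      rintro ⟨j, hj⟩
      dsimp only at hj
      rw [Nat.mod_eq_of_lt (by omega)] at hj
      rcases lt_or_ge j.val k.val with hjk | hjk
      · have := c.monotone_sizeUpTo (show j.val + 1 ≤ k.val by omega)
        omega
      · have := c.monotone_sizeUpTo (show k.val + 1 ≤ j.val + 1 by omega)
        omega
    · rw [ofComposition_eq_one]
      refine ⟨k, ?_⟩
      dsimp only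
      rw [Nat.mod_eq_of_lt (by omega)]
      omega
  · intro k hk j hj h
    simp only [mem_filter, mem_univ, true_and, Fin.mk.injEq] at hk hj h
    have h1 := hs k
    have h2 := hs j
    ext
    rcases lt_trichotomy k.val j.val with hjk | hjk | hjk
    · have := c.monotone_sizeUpTo (show k.val + 1 ≤ j.val by omega)
      omega
    · exact hjk
    · have := c.monotone_sizeUpTo (show j.val + 1 ≤ k.val by omega)
      omega
  · intro i hi
    simp only [mem_filter, mem_univ, true_and] at hi
    obtain ⟨h1, h2⟩ := hi
    have hiN := i.isLt
    have hlt : i.val + a < N := by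
      -- If the occurrence wrapped, the last place, which holds a one, would lie among its zeros.
      by_contra hcon
      have hlast := ofComposition_last c ⟨(i.val + (N - 1 - i.val)) % N, Nat.mod_lt _ i.pos⟩ (by
        dsimp only
        rw [Nat.mod_eq_of_lt (by omega)]
        omega)
      rw [h1 (N - 1 - i.val) (by omega)] at hlast
      exact absurd hlast (by decide)
    obtain ⟨k, hk⟩ := (ofComposition_eq_one _ _).1 h2
    dsimp only at hk
    rw [Nat.mod_eq_of_lt hlt] at hk
    have h3 := hs k
    refine ⟨k, ?_, Fin.ext (by change c.sizeUpTo (k + 1) - (a + 1) = i; omega)⟩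
    simp only [mem_filter, mem_univ, true_and]
    by_contra hcon
    have hk0 : k.val ≠ 0 := by
      intro h
      rw [h, c.sizeUpTo_zero] at h3
      rw [h] at hk
      omega
    have h4 : c.sizeUpTo k = c.sizeUpTo (k.val - 1 + 1) := by
      rw [Nat.sub_add_cancel (by omega)]
    have h5 := c.one_le_blocksFun k
    -- Were block `k` too short, the one closing the previous block would lie among the zeros.
    refine (ofComposition_eq_zero _ _).1 (h1 (c.sizeUpTo k - 1 - i.val) (by omega))
      ⟨⟨k.val - 1, by omega⟩, ?_⟩
    dsimp only
    rw [Nat.mod_eq_of_lt (by omega)]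
    omega

theorem occ_zerosOne_zero {N : ℕ} (S : Fin N → Fin 2) : occ (zerosOne 0) S = ones S := by
  rw [occ_zerosOne]
  refine congrArg card (filter_congr fun i _ => ?_)
  simp [Nat.mod_eq_of_lt i.isLt]

theorem countP_blocks_zero {N : ℕ} (c : Composition N) :
    c.blocks.countP (fun x => 0 < x) = c.length := by
  refine List.countP_eq_length.2 fun x hx => ?_
  simpa using c.blocks_pos hx

/-- Sequences with `n` ones, of which one is marked, are rotated compositions into `n` parts. -/
theorem mul_card_occ {N n : ℕ} (hN : 0 < N) (P : (ℕ → ℕ) → Prop) [DecidablePred P] :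
    n * #{S : Fin N → Fin 2 | ones S = n ∧ P (fun a => occ (zerosOne a) S)} =
      N * #{c : Composition N | c.length = n ∧ P (fun a => c.blocks.countP (fun x => a < x))} := by
  have : NeZero N := ⟨hN.ne'⟩
  rw [mul_card_ones (fun S : Fin N → Fin 2 => P (fun a => occ (zerosOne a) S)) ?_
    ⟨N - 1, by omega⟩]
  · congr 1
    symm
    have hones : ∀ c : Composition N, ones (ofComposition c) = c.length := fun c => by
      rw [← occ_zerosOne_zero, occ_ofComposition, countP_blocks_zero]
    refine card_bij (fun c _ => ofComposition c) ?_ ?_ ?_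
    · intro c hc
      simp only [mem_filter, mem_univ, true_and] at hc ⊢
      refine ⟨ofComposition_last c _ (Nat.sub_add_cancel hN), (hones c).trans hc.1, ?_⟩
      simpa only [occ_ofComposition] using hc.2
    · intro c _ d _ h
      exact ofComposition_injective N h
    · intro S hS
      simp only [mem_filter, mem_univ, true_and] at hS
      obtain ⟨h1, h2, h3⟩ := hS
      obtain ⟨c, rfl⟩ := exists_ofComposition S _ (Nat.sub_add_cancel hN) h1
      refine ⟨c, ?_, rfl⟩
      simp only [mem_filter, mem_univ, true_and]
      exact ⟨(hones c).symm.trans h2, by simpa only [occ_ofComposition] using h3⟩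
  · intro S k h
    simpa only [occ_comp_add] using h

/-! ### Column heights, joint counts and chains -/

/-- The number of functions from `n` places to `ℕ` with sum `m` for which exactly `v t` of the
values exceed `t`, for each `t`. -/
def columnCount {r : ℕ} (n m : ℕ) (v : Fin (r + 1) → ℕ) : ℕ :=
  n.choose (v 0) * (∏ t : Fin r, (v t.castSucc).choose (v t.succ)) *
    if ∑ t, v t ≤ m then Nat.multichoose (v (Fin.last r)) (m - ∑ t, v t) else 0

theorem card_composition_columns {r : ℕ} (M n : ℕ) (v : Fin (r + 1) → ℕ) (hv : v 0 = n) :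
    #{c : Composition M | c.length = n ∧
      ∀ t : Fin (r + 1), c.blocks.countP (fun x => t.val < x) = v t} = columnCount n M v := by
  rw [card_composition_eq M n (fun u => ∀ t : Fin (r + 1), u t = v t)]
  have := card_piAntidiag_columns r v (univ : Finset (Fin n)) M
  rw [card_univ, Fintype.card_fin] at this
  rw [columnCount, ← this]
  refine congrArg card (filter_congr fun g _ => ?_)
  exact ⟨fun h => h.2, fun h => ⟨(h 0).trans hv, h⟩⟩

/-- A full first column involves no choice and uses `n` cells. This is the passage from compositions
of `m + n`, one cell per digit, to the `m` zeros alone. -/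
theorem columnCount_cons {r : ℕ} (n m : ℕ) (v : Fin (r + 1) → ℕ) :
    columnCount n (m + n) (Fin.cons n v : Fin (r + 2) → ℕ) = columnCount n m v := by
  unfold columnCount
  rw [Fin.prod_univ_succ (n := r), Fin.sum_univ_succ (n := r + 1), ← Fin.succ_last]
  simp only [Fin.castSucc_zero, Fin.cons_zero, Fin.cons_succ, ← Fin.succ_castSucc]
  rw [Nat.choose_self, one_mul]
  congr 1
  rw [show m + n - (n + ∑ t, v t) = m - ∑ t, v t by omega]
  exact if_congr (by omega) rfl rfl

theorem mul_jointT {s : ℕ} (m n : ℕ) (hn : 1 ≤ n) (v : Fin (s + 2) → ℕ) :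
    n * jointT m n v = (m + n) * columnCount n m v := by
  have h := mul_card_occ (N := m + n) (n := n) (by omega)
    (fun u => ∀ t : Fin (s + 2), u (t.val + 1) = v t)
  refine h.trans ?_
  rw [← columnCount_cons, ← card_composition_columns (m + n) n (Fin.cons n v) rfl]
  congr 2
  refine filter_congr fun c _ => ?_
  rw [Fin.forall_fin_succ (n := s + 2)]
  simp only [Fin.cons_succ, Fin.val_succ]
  refine and_congr_right fun h => ⟨fun h' => ⟨?_, h'⟩, fun h' => h'.2⟩
  exact (countP_blocks_zero c).trans h

theorem forall_eq_ext {s : ℕ} (j k : ℕ) (f : Fin s → ℕ) (u : ℕ → ℕ) :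
    (∀ t : Fin (s + 2), u t = ext j k f t) ↔
      u 0 = j ∧ u (s + 1) = k ∧ (fun t : Fin s => u (t + 1)) = f := by
  rw [Fin.forall_fin_succ (n := s + 1), Fin.forall_fin_succ' (n := s), funext_iff]
  simp only [ext, Fin.cons_zero, Fin.cons_succ, Fin.snoc_castSucc, Fin.snoc_last, Fin.val_succ,
    Fin.val_castSucc, Fin.val_last]
  exact and_congr_right fun _ => and_comm

theorem mem_chains {s j k : ℕ} (f : Fin s → ℕ) :
    f ∈ chains s j k ↔ Antitone (ext j k f) := by
  rw [chains, mem_filter, Fin.antitone_iff_succ_le, Fintype.mem_piFinset]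
  refine and_iff_right_of_imp fun h t => ?_
  have := Fin.antitone_iff_succ_le.2 h (Fin.zero_le t.castSucc.succ)
  simp only [ext, Fin.cons_zero, Fin.cons_succ, Fin.snoc_castSucc] at this
  rw [mem_range]
  omega

/-- Sorting by the intermediate values of `u x`; since `u x` decreases, these values form a chain
between the fixed ends. -/
theorem card_eq_sum_chains {α : Type*} (X : Finset α) (u : α → ℕ → ℕ)
    (hu : ∀ x, Antitone (u x)) (s j k : ℕ) :
    #{x ∈ X | u x 0 = j ∧ u x (s + 1) = k} =
      ∑ f ∈ chains s j k, #{x ∈ X | ∀ t : Fin (s + 2), u x t = ext j k f t} := by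
  rw [card_eq_sum_card_fiberwise (f := fun x (t : Fin s) => u x (t + 1)) (t := chains s j k)]
  · refine sum_congr rfl fun f _ => ?_
    rw [filter_filter]
    refine congrArg card (filter_congr fun x _ => ?_)
    rw [forall_eq_ext, and_assoc]
  · intro x hx
    rw [mem_coe, mem_filter] at hx
    have := (forall_eq_ext j k _ (u x)).2 ⟨hx.2.1, hx.2.2, rfl⟩
    rw [mem_coe, mem_chains, ← funext this]
    exact fun a b hab => hu x hab

/-- The offset `b` is `0` for compositions of `m`, and `1` for sequences, where the first column
consists of the ones. -/
theorem antitone_countP (L : List ℕ) (b : ℕ) :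
    Antitone fun t => L.countP (fun x => t + b < x) := by
  intro a a' h
  refine List.countP_mono_left fun x _ hx => ?_
  simp only [decide_eq_true_eq] at hx ⊢
  omega

theorem card_deleteColumns (s m h l : ℕ) :
    #{a : Composition m | a.length = h ∧ (deleteColumns (s + 1) a).length = l} =
      ∑ f ∈ chains s h l, columnCount h m (ext h l f) := by
  have := card_eq_sum_chains (univ : Finset (Composition m))
    (fun c t => c.blocks.countP (fun x => t + 0 < x)) (fun c => antitone_countP _ 0) s h l
  simp only [add_zero, countP_blocks_zero] at this
  simp only [length_deleteColumns, this]
  refine sum_congr rfl fun f _ => ?_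
  rw [← card_composition_columns m h (ext h l f) rfl]
  refine congrArg card (filter_congr fun c _ => ?_)
  refine ⟨fun h => ⟨(countP_blocks_zero c).symm.trans (h 0), h⟩, fun h => h.2⟩

theorem mul_T_eq_card (m n a l : ℕ) (hn : 1 ≤ n) :
    n * T m n (zerosOne a) l = (m + n) *
      #{c : Composition (m + n) | c.length = n ∧ c.blocks.countP (fun x => a < x) = l} :=
  mul_card_occ (N := m + n) (n := n) (by omega) (fun u => u a = l)

theorem mul_T (s m n l : ℕ) (hn : 1 ≤ n) :
    n * T m n (zerosOne (s + 2)) l =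
      (m + n) * ∑ h ∈ range (n + 1), ∑ f ∈ chains s h l, columnCount n m (ext h l f) := by
  rw [mul_T_eq_card _ _ _ _ hn]
  congr 1
  -- The number `h` of occurrences of `01` is not prescribed, so it is summed over.
  rw [card_eq_sum_card_fiberwise (f := fun c : Composition (m + n) =>
    c.blocks.countP (fun x => 1 < x)) (t := range (n + 1))]
  · refine sum_congr rfl fun h _ => ?_
    have := card_eq_sum_chains ({c | c.length = n} : Finset (Composition (m + n)))
      (fun c t => c.blocks.countP (fun x => t + 1 < x)) (fun c => antitone_countP _ 1) s h l
    simp only [filter_filter] at this ⊢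
    rw [zero_add] at this
    rw [filter_congr fun c _ => (by tauto : _ ↔ c.length = n ∧
      c.blocks.countP (fun x => 1 < x) = h ∧ c.blocks.countP (fun x => s + 1 + 1 < x) = l), this]
    refine sum_congr rfl fun f _ => ?_
    rw [← columnCount_cons, ←
      card_composition_columns (m + n) n (Fin.cons n (ext h l f)) rfl]
    refine congrArg card (filter_congr fun c _ => ?_)
    rw [Fin.forall_fin_succ (n := s + 2)]
    simp only [Fin.cons_succ, Fin.val_succ]
    refine and_congr_right fun h => ⟨fun h' => ⟨?_, h'⟩, fun h' => h'.2⟩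
    exact (countP_blocks_zero c).trans h
  · intro c hc
    simp only [coe_filter, Set.mem_ofPred_eq] at hc
    have : c.blocks.countP (fun x => 1 < x) ≤ c.length := List.countP_le_length
    rw [mem_coe, mem_range]
    dsimp only
    omega

/-! ### Closed forms of the numbers `c` -/

/-- Absorption. For `g < k` both binomials vanish, which also covers `g = 0`, where the quotient is
a division by zero. -/
theorem div_mul_zchoose (g : ℤ) (k : ℕ) (hk : 1 ≤ k) :
    (k : ℚ) / g * (zchoose g k : ℚ) = (zchoose (g - 1) ((k : ℤ) - 1) : ℚ) := by
  unfold zchoose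
  by_cases h : (k : ℤ) ≤ g
  · obtain ⟨k, rfl⟩ := Nat.exists_eq_add_of_le' hk
    obtain ⟨G, rfl⟩ : ∃ G : ℕ, g = ((G + 1 : ℕ) : ℤ) := ⟨(g - 1).toNat, by omega⟩
    rw [if_pos ⟨by omega, h⟩, if_pos (by omega)]
    have h1 : (((G + 1 : ℕ) : ℤ) - 1).toNat = G := by omega
    have h2 : (((k + 1 : ℕ) : ℤ) - 1).toNat = k := by omega
    rw [h1, h2, Int.toNat_natCast, Int.toNat_natCast]
    have := Nat.add_one_mul_choose_eq G k
    have h3 : ((G : ℚ) + 1) * G.choose k = (G + 1).choose (k + 1) * (k + 1) := by exact_mod_cast this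
    push_cast
    field_simp
    linarith
  · rw [if_neg (by omega), if_neg (by omega)]
    simp

/-- Stars and bars: `m - F` cells fall to `k` rows, each receiving at least one. The vanishing of
`zchoose` replaces the guard. -/
theorem multichoose_eq_zchoose (k F m : ℕ) (hk : 1 ≤ k) :
    (if F + k ≤ m then k.multichoose (m - (F + k)) else 0) =
      zchoose ((m : ℤ) - F - 1) ((k : ℤ) - 1) := by
  unfold zchoose
  by_cases h : F + k ≤ m
  · rw [if_pos h, if_pos (by omega), Nat.multichoose_eq]
    obtain ⟨e, rfl⟩ := Nat.exists_eq_add_of_le h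
    obtain ⟨k, rfl⟩ := Nat.exists_eq_add_of_le' hk
    have h1 : (((F + (k + 1) + e : ℕ) : ℤ) - F - 1).toNat = k + e := by omega
    have h2 : (((k + 1 : ℕ) : ℤ) - 1).toNat = k := by omega
    rw [h1, h2, Nat.add_sub_cancel_left, Nat.choose_symm_add]
    congr 1
    omega
  · rw [if_neg h, if_neg (by omega)]

theorem sum_ext {s : ℕ} (j k : ℕ) (f : Fin s → ℕ) : ∑ t, ext j k f t = j + ∑ t, f t + k := by
  rw [Fin.sum_univ_succ, Fin.sum_univ_castSucc]
  simp [ext, add_assoc]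

theorem ext_last {s : ℕ} (j k : ℕ) (f : Fin s → ℕ) : ext j k f (Fin.last (s + 1)) = k := by
  rw [← Fin.succ_last]
  simp [ext]

theorem cBar_eq {s : ℕ} (i j : ℕ) (f : Fin s → ℕ) (k : ℕ) :
    cBar s i j f k =
      (∏ t : Fin (s + 1), ((ext j k f t.castSucc).choose (ext j k f t.succ) : ℚ)) *
        (if k = 0 then (if j + ∑ t, f t = i then 1 else 0) else
          (zchoose ((i : ℤ) - j - ∑ t, (f t : ℤ) - 1) ((k : ℤ) - 1) : ℚ)) := by
  unfold cBar
  dsimp only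
  congr 1
  split_ifs with h1 h2 h3 h3
  · rfl
  · refine absurd ?_ h3
    zify
    omega
  · refine absurd ?_ h2
    rw [← h3]
    push_cast
    ring
  · rfl
  · exact_mod_cast div_mul_zchoose _ k (by omega)

theorem columnCount_ext {s : ℕ} (n m h l : ℕ) (f : Fin s → ℕ) :
    (columnCount n m (ext h l f) : ℚ) = n.choose h * cBar s m h f l := by
  rw [cBar_eq, columnCount, sum_ext, ext_last, show ext h l f 0 = h from rfl]
  push_cast
  rw [mul_assoc]
  congr 2
  split_ifs with h1 h2 h3 h3 h3
  · subst h2 h3; simp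
  · subst h2
    -- With an empty last column there are no rows to receive the remaining cells.
    rw [Nat.multichoose_eq, Nat.choose_eq_zero_of_lt (by omega), Nat.cast_zero]
  · have := multichoose_eq_zchoose l (h + ∑ t, f t) m (by omega)
    rw [if_pos h1] at this
    rw [this]
    congr 2
    push_cast
    ring
  · omega
  · rfl
  · have := multichoose_eq_zchoose l (h + ∑ t, f t) m (by omega)
    rw [if_neg h1] at this
    rw [← Nat.cast_zero, this]
    congr 2
    push_cast
    ring

theorem choose_mul_choose_eq_zchoose (n k l : ℕ) :
    n.choose k * k.choose l = n.choose l * zchoose ((n : ℤ) - l) ((k : ℤ) - l) := by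
  unfold zchoose
  split_ifs with h
  · rw [Nat.choose_mul (by omega)]
    congr 2 <;> omega
  · rcases lt_or_ge k l with h1 | h1
    · rw [Nat.choose_eq_zero_of_lt h1, mul_zero, mul_zero]
    · rw [Nat.choose_eq_zero_of_lt (by omega : n < k), zero_mul, mul_zero]

/-- Both sides count descending flags of subsets of sizes `v t` in a set of size `v 0`: on the left
from the largest inwards, on the right by choosing the smallest and enlarging it stepwise. The
induction splits off the last factor by trinomial revision. -/
theorem prod_choose_eq_nested (s : ℕ) (v : Fin (s + 2) → ℕ) (hv : Antitone v) :
    ∏ t : Fin (s + 1), (v t.castSucc).choose (v t.succ) =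
      (v 0).choose (v (Fin.last (s + 1))) *
        ∏ t : Fin s, (v 0 - v t.succ.succ).choose (v t.succ.castSucc - v t.succ.succ) := by
  induction s with
  | zero => simp
  | succ s ih =>
    rw [Fin.prod_univ_castSucc (n := s + 1)]
    conv_rhs => rw [Fin.prod_univ_castSucc (n := s)]
    have h := ih (fun t => v t.castSucc) (hv.comp_monotone Fin.strictMono_castSucc.monotone)
    simp only [Fin.castSucc_zero, ← Fin.succ_castSucc] at h ⊢
    rw [h]
    have h2 := Nat.choose_mul (n := v 0) (hv (Fin.le_last (Fin.last (s + 1)).castSucc))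
    simp only [Fin.succ_last, Fin.succ_castSucc] at h2 ⊢
    rw [mul_right_comm, h2]
    ring

theorem cBar_eq_nested {s : ℕ} (i j : ℕ) (f : Fin s → ℕ) (k : ℕ) (hf : f ∈ chains s j k) :
    cBar s i j f k = (j.choose k : ℚ) * nested j k f *
      (if k = 0 then (if j + ∑ t, f t = i then 1 else 0) else
        (zchoose ((i : ℤ) - j - ∑ t, (f t : ℤ) - 1) ((k : ℤ) - 1) : ℚ)) := by
  rw [cBar_eq]
  congr 1
  have := prod_choose_eq_nested s _ ((mem_chains f).1 hf)
  rw [ext_last] at this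
  exact_mod_cast this

theorem c_eq_of_pos (s i j k : ℕ) (hk : 1 ≤ k) :
    c s i j k = (j.choose k : ℚ) * ∑ f ∈ chains s j k, (nested j k f : ℚ) *
      (zchoose ((i : ℤ) - j - (∑ t, (f t : ℤ)) - 1) ((k : ℤ) - 1) : ℚ) := by
  rw [c, mul_sum]
  refine sum_congr rfl fun f hf => ?_
  rw [cBar_eq_nested _ _ _ _ hf, if_neg (by omega), mul_assoc]

theorem c_zero (s i j : ℕ) :
    c s i j 0 = ∑ f ∈ chains s j 0 with j + ∑ t, f t = i, (nested j 0 f : ℚ) := by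
  rw [c, sum_filter]
  refine sum_congr rfl fun f hf => ?_
  rw [cBar_eq_nested _ _ _ _ hf, if_pos rfl]
  simp

theorem le_of_mem_chains {s j k : ℕ} {f : Fin s → ℕ} (hf : f ∈ chains s j k) (t : Fin s) :
    k ≤ f t ∧ f t ≤ j := by
  have h := (mem_chains f).1 hf
  have h1 := h (Fin.zero_le t.castSucc.succ)
  have h2 := h (Fin.le_last t.castSucc.succ)
  rw [ext_last] at h2
  simp only [ext, Fin.cons_zero, Fin.cons_succ, Fin.snoc_castSucc] at h1 h2
  exact ⟨h2, h1⟩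

theorem le_of_chains_nonempty {s j k : ℕ} {f : Fin s → ℕ} (hf : f ∈ chains s j k) : k ≤ j := by
  have h2 := (mem_chains f).1 hf (Fin.zero_le (Fin.last (s + 1)))
  rwa [ext_last] at h2

theorem c_zero_eq_ite (s i j : ℕ) :
    c s i j 0 = if i ≤ (s + 1) * j then
      ∑ f ∈ chains s j 0 with j + ∑ t, f t = i, (nested j 0 f : ℚ) else 0 := by
  rw [c_zero]
  split_ifs with h
  · rfl
  · rw [filter_false_of_mem, sum_empty]
    intro f hf hi
    -- Every entry of a chain is at most `j`, so the inner sum is empty beyond `(s + 1) * j`.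
    have : ∑ t, f t ≤ s * j := by
      simpa using sum_le_card_nsmul univ f j fun t _ => (le_of_mem_chains hf t).2
    apply h
    rw [add_mul]
    omega

theorem eq_div_mul {n N : ℕ} {x y : ℚ} (hn : 1 ≤ n) (h : (n : ℚ) * x = N * y) :
    x = (N : ℚ) / n * y := by
  have : (n : ℚ) ≠ 0 := by positivity
  field_simp
  linarith

/-! ### Distributions of the strings -/

theorem jointT_eq {s : ℕ} (m n : ℕ) (hn : 1 ≤ n) (h l : ℕ) (f : Fin s → ℕ) :
    (jointT m n (ext h l f) : ℚ) = ((m + n : ℕ) : ℚ) / n * (n.choose h * cBar s m h f l) := by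
  refine eq_div_mul hn ?_
  rw [← columnCount_ext]
  exact_mod_cast mul_jointT m n hn _

theorem jointT_eq_of_pos {s : ℕ} (m n : ℕ) (hn : 1 ≤ n) (h l : ℕ) (hh : 1 ≤ h) (f : Fin s → ℕ) :
    (jointT m n (ext h l f) : ℚ) =
      ((m + n : ℕ) : ℚ) / h * cBar s m h f l * ((n - 1).choose (h - 1) : ℚ) := by
  rw [jointT_eq m n hn]
  obtain ⟨n, rfl⟩ := Nat.exists_eq_add_of_le' hn
  obtain ⟨h, rfl⟩ := Nat.exists_eq_add_of_le' hh
  have h1 : ((n : ℚ) + 1) * n.choose h = (n + 1).choose (h + 1) * (h + 1) := by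
    exact_mod_cast Nat.add_one_mul_choose_eq n h
  have h2 : ((n + 1).choose (h + 1) : ℚ) / (n + 1) = n.choose h / (h + 1) := by
    rw [div_eq_div_iff (by positivity) (by positivity)]
    linarith
  simp only [Nat.add_sub_cancel]
  push_cast
  linear_combination ((m : ℚ) + (n + 1)) * cBar s m (h + 1) f l * h2

theorem ext_one (h l x : ℕ) : ext h l ![x] = ![h, x, l] := by
  funext t
  fin_cases t <;> rfl

theorem cBar_one (m h x l : ℕ) :
    cBar 1 m h ![x] l = (h.choose x * x.choose l : ℕ) *
      (if l = 0 then (if h + x = m then 1 else 0) else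
        (zchoose ((m : ℤ) - h - x - 1) ((l : ℤ) - 1) : ℚ)) := by
  rw [cBar_eq, ext_one, Fin.prod_univ_two]
  simp

theorem jointT_three (m n h x l : ℕ) (hn : 1 ≤ n) (hl : 1 ≤ l) :
    (jointT m n ![h, x, l] : ℚ) = ((m + n : ℕ) : ℚ) / n *
      ((n.choose h * (h.choose x * x.choose l) : ℕ) *
        (zchoose ((m : ℤ) - h - x - 1) ((l : ℤ) - 1) : ℚ)) := by
  rw [← ext_one, jointT_eq m n hn, cBar_one, if_neg (by omega)]
  push_cast
  ring

theorem jointT_three_zero (m n h : ℕ) (hn : 1 ≤ n) (h1 : h ≤ m) :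
    (jointT m n ![h, m - h, 0] : ℚ) = ((m + n : ℕ) : ℚ) / n * (n.choose (m - h) : ℚ) *
      (zchoose ((n : ℤ) - m + h) (2 * (h : ℤ) - m) : ℚ) := by
  rw [← ext_one, jointT_eq m n hn, cBar_one, if_pos rfl, if_pos (by omega)]
  have := choose_mul_choose_eq_zchoose n h (m - h)
  rw [Nat.cast_sub h1, show (n : ℤ) - (m - h) = n - m + h by ring,
    show (h : ℤ) - (m - h) = 2 * h - m by ring] at this
  rw [mul_assoc, ← Nat.cast_mul, ← this]
  simp

theorem T_eq_sum_c (s m n l : ℕ) (hn : 1 ≤ n) :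
    (T m n (zerosOne (s + 2)) l : ℚ) =
      ((m + n : ℕ) : ℚ) / n * ∑ h ∈ range (n + 1), c s m h l * (n.choose h : ℚ) := by
  refine eq_div_mul hn ?_
  have h1 : ∑ h ∈ range (n + 1), c s m h l * (n.choose h : ℚ) =
      ((∑ h ∈ range (n + 1), ∑ f ∈ chains s h l, columnCount n m (ext h l f) : ℕ) : ℚ) := by
    push_cast
    refine sum_congr rfl fun h _ => ?_
    rw [c, sum_mul]
    refine sum_congr rfl fun f _ => ?_
    rw [columnCount_ext, mul_comm]
  rw [h1]
  exact_mod_cast mul_T s m n l hn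

theorem T_eq_of_pos (s m n l : ℕ) (hn : 1 ≤ n) (hl : 1 ≤ l) :
    (T m n (zerosOne (s + 2)) l : ℚ) = ((m + n : ℕ) : ℚ) / n * (n.choose l : ℚ) *
      ∑ h ∈ Icc l (min (m - (s + 1) * l) n), ∑ f ∈ chains s h l,
        (nested h l f : ℚ) * ((n - l).choose (h - l) : ℚ) *
          (zchoose ((m : ℤ) - h - (∑ t, (f t : ℤ)) - 1) ((l : ℤ) - 1) : ℚ) := by
  rw [T_eq_sum_c s m n l hn, mul_assoc]
  congr 1
  rw [mul_sum]
  symm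
  -- Trinomial revision of `C(n, h) C(h, l)` frees the factor `C(n, l)` from the summation index.
  have key : ∀ h, (n.choose l : ℚ) * ∑ f ∈ chains s h l,
        (nested h l f : ℚ) * ((n - l).choose (h - l) : ℚ) *
          (zchoose ((m : ℤ) - h - (∑ t, (f t : ℤ)) - 1) ((l : ℤ) - 1) : ℚ) =
      c s m h l * (n.choose h : ℚ) := by
    intro h
    rw [c_eq_of_pos s m h l hl, mul_sum, mul_sum, sum_mul]
    refine sum_congr rfl fun f hf => ?_
    have : (n.choose h : ℚ) * h.choose l = n.choose l * (n - l).choose (h - l) := by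
      exact_mod_cast Nat.choose_mul (n := n) (le_of_chains_nonempty hf)
    linear_combination (-(nested h l f : ℚ) *
      (zchoose ((m : ℤ) - h - (∑ t, (f t : ℤ)) - 1) ((l : ℤ) - 1) : ℚ)) * this
  rw [sum_congr rfl fun h _ => key h]
  refine sum_subset (fun h hh => ?_) fun h hh hh' => ?_
  · rw [mem_Icc] at hh
    rw [mem_range]
    omega
  · rw [c_eq_of_pos s m h l hl, sum_eq_zero, mul_zero, zero_mul]
    intro f hf
    have h1 := le_of_chains_nonempty hf
    -- Each `f t` is at least `l`, so a nonzero last binomial forces `h + (s + 1) * l ≤ m`.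
    have h2 : s * l ≤ ∑ t, f t := by
      simpa using card_nsmul_le_sum univ f l fun t _ => (le_of_mem_chains hf t).1
    rw [mem_range] at hh
    rw [mem_Icc, add_mul] at hh'
    rw [zchoose, if_neg, Nat.cast_zero, mul_zero]
    rintro ⟨-, h3⟩
    rw [← Nat.cast_sum] at h3
    omega

theorem T_zero_eq (s m n : ℕ) (hn : 1 ≤ n) :
    (T m n (zerosOne (s + 2)) 0 : ℚ) = ((m + n : ℕ) : ℚ) / n *
      ∑ h ∈ range (min m n + 1), ∑ f ∈ chains s h 0 with h + ∑ t, f t = m,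
        (nested h 0 f : ℚ) * (n.choose h : ℚ) := by
  rw [T_eq_sum_c s m n 0 hn]
  congr 1
  symm
  simp only [← sum_mul, ← c_zero]
  refine sum_subset (range_subset_range.2 (by omega)) fun h hh hh' => ?_
  rw [c_zero, filter_false_of_mem, sum_empty, zero_mul]
  intro f _ hf
  rw [mem_range] at hh hh'
  omega

theorem sum_chains_one (h l : ℕ) (F : (Fin 1 → ℕ) → ℚ) :
    ∑ f ∈ chains 1 h l, F f = ∑ x ∈ Icc l h, F ![x] := by
  have h1 : ∀ f : Fin 1 → ℕ, ![f 0] = f := fun f => by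
    funext t
    fin_cases t
    rfl
  refine sum_bij' (fun f _ => f 0) (fun x _ => ![x]) ?_ ?_ ?_ ?_ ?_
  · intro f hf
    exact mem_Icc.2 (le_of_mem_chains hf 0)
  · intro x hx
    rw [mem_Icc] at hx
    rw [mem_chains, ext_one, Fin.antitone_iff_succ_le, Fin.forall_fin_two]
    exact ⟨hx.2, hx.1⟩
  · intro f _
    exact h1 f
  · intro x _
    rfl
  · intro f _
    rw [h1]

theorem nested_one (h l x : ℕ) : nested h l ![x] = (h - l).choose (x - l) := by
  unfold nested
  rw [ext_one]
  simp

theorem T_three_of_pos (m n l : ℕ) (hn : 1 ≤ n) (hl : 1 ≤ l) :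
    (T m n (zerosOne 3) l : ℚ) = ((m + n : ℕ) : ℚ) / n * (n.choose l : ℚ) *
      ∑ h ∈ Icc l (min (m - 2 * l) n), ∑ x ∈ Icc l h,
        ((n - x).choose (h - x) : ℚ) * ((n - l).choose (x - l) : ℚ) *
          (zchoose ((m : ℤ) - h - x - 1) ((l : ℤ) - 1) : ℚ) := by
  rw [T_eq_of_pos 1 m n l hn hl]
  congr 1
  refine sum_congr rfl fun h hh => ?_
  rw [sum_chains_one]
  refine sum_congr rfl fun x hx => ?_
  rw [mem_Icc] at hh hx
  rw [nested_one]
  have h1 := Nat.choose_mul (n := n - l) (k := h - l) (s := x - l) (by omega)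
  rw [show n - l - (x - l) = n - x by omega, show h - l - (x - l) = h - x by omega] at h1
  have h2 : ((n - l).choose (h - l) : ℚ) * (h - l).choose (x - l) =
      (n - l).choose (x - l) * (n - x).choose (h - x) := by exact_mod_cast h1
  rw [mul_comm ((h - l).choose (x - l) : ℚ), h2, mul_comm ((n - l).choose (x - l) : ℚ)]
  simp

theorem T_three_zero (m n : ℕ) (hn : 1 ≤ n) :
    (T m n (zerosOne 3) 0 : ℚ) = ((m + n : ℕ) : ℚ) / n *
      ∑ h ∈ Icc ((m + 1) / 2) (min n m),
        (n.choose (m - h) : ℚ) * ((n + h - m).choose (2 * h - m) : ℚ) := by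
  rw [T_zero_eq 1 m n hn]
  congr 1
  symm
  have key : ∀ h, ∑ f ∈ chains 1 h 0 with h + ∑ t, f t = m, (nested h 0 f : ℚ) * (n.choose h : ℚ) =
      ∑ x ∈ Icc 0 h with h + x = m, (h.choose x : ℚ) * n.choose h := by
    intro h
    rw [sum_filter, sum_chains_one, sum_filter]
    refine sum_congr rfl fun x _ => ?_
    simp [nested_one]
  rw [sum_congr rfl fun h _ => key h]
  -- The only possible chain entry is `m - h`, and it is at most `h` exactly from `⌈m / 2⌉` on.
  refine sum_subset_zero_on_sdiff (fun h hh => ?_) (fun h hh => ?_) fun h hh => ?_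
  · rw [mem_Icc] at hh
    rw [mem_range]
    omega
  · rw [mem_sdiff, mem_range, mem_Icc] at hh
    rw [filter_false_of_mem, sum_empty]
    intro x hx
    rw [mem_Icc] at hx
    omega
  · rw [mem_Icc] at hh
    rw [show {x ∈ Icc 0 h | h + x = m} = {m - h} by
      ext x
      rw [mem_filter, mem_Icc, mem_singleton]
      omega, sum_singleton]
    have h1 := Nat.choose_mul (n := n) (k := h) (s := m - h) (by omega)
    rw [show h - (m - h) = 2 * h - m by omega] at h1
    rw [mul_comm (h.choose (m - h) : ℚ), ← Nat.cast_mul (n.choose h), h1]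
    by_cases h2 : m - h ≤ n
    · rw [show n - (m - h) = n + h - m by omega, Nat.cast_mul]
    · rw [Nat.choose_eq_zero_of_lt (by omega : n < m - h)]
      simp

/-! ### The cyclic Kaplansky lemma -/

/-- All `n` parts exceed `p`, so the first `p + 1` columns are all full and the column count has
constant heights `n`. -/
theorem T_full (m n p : ℕ) (hn : 1 ≤ n) :
    (T m n (zerosOne p) n : ℚ) = ((m + n : ℕ) : ℚ) / n *
      (zchoose ((m : ℤ) + n - p * n - 1) ((n : ℤ) - 1) : ℚ) := by
  refine eq_div_mul hn ?_
  have h1 := mul_T_eq_card m n p n hn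
  have h2 := card_composition_columns (m + n) n (fun _ : Fin (p + 1) => n) rfl
  have h3 := multichoose_eq_zchoose n (p * n) (m + n) hn
  have h4 : ((m + n : ℕ) : ℤ) - (p * n : ℕ) - 1 = (m : ℤ) + n - p * n - 1 := by
    push_cast
    ring
  have h5 : columnCount n (m + n) (fun _ : Fin (p + 1) => n) =
      zchoose ((m : ℤ) + n - p * n - 1) ((n : ℤ) - 1) := by
    rw [← h4, ← h3, columnCount]
    simp only [Nat.choose_self, prod_const_one, one_mul, sum_const, card_univ, Fintype.card_fin,
      smul_eq_mul, add_mul]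
  have h6 : ∀ c : Composition (m + n),
      c.length = n ∧ c.blocks.countP (fun x => p < x) = n ↔
        c.length = n ∧ ∀ t : Fin (p + 1), c.blocks.countP (fun x => t.val < x) = n := by
    intro c
    refine and_congr_right fun hc => ⟨fun h t => le_antisymm ?_ ?_, fun h => ?_⟩
    · exact List.countP_le_length.trans_eq hc
    · have := antitone_countP c.blocks 0 (Nat.lt_succ_iff.1 t.isLt)
      simp only [add_zero] at this
      omega
    · exact h (Fin.last p)
  rw [← h5, ← h2, ← filter_congr fun c _ => h6 c]
  exact_mod_cast h1

theorem T_full_eq (m n p : ℕ) (hn : 1 ≤ n) (hp : p * n < m + n) :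
    (T m n (zerosOne p) n : ℚ) = ((m + n : ℕ) : ℚ) / ((m + n - p * n : ℕ) : ℚ) *
      ((m + n - p * n).choose n : ℚ) := by
  obtain ⟨g, hg⟩ := Nat.exists_eq_add_of_lt hp
  rw [T_full m n p hn, show (m : ℤ) + n - p * n - 1 = ((g + 1 : ℕ) : ℤ) - 1 by
    push_cast; push_cast [← @Nat.cast_inj ℤ] at hg; linarith,
    ← div_mul_zchoose _ n hn, show m + n - p * n = g + 1 by omega]
  have h1 : zchoose ((g + 1 : ℕ) : ℤ) n = (g + 1).choose n := by
    unfold zchoose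
    split_ifs with h
    · simp
    · rw [Nat.choose_eq_zero_of_lt (by omega)]
  rw [h1]
  have : (n : ℚ) ≠ 0 := by positivity
  push_cast
  field_simp

theorem occ_eq_ones_iff {N : ℕ} (p : ℕ) (S : Fin N → Fin 2) (hN : 0 < N) :
    occ (zerosOne p) S = ones S ↔
      ∀ j : Fin N, S j = 1 → ∀ t, t < p → ∀ i : Fin N, (i.val + (t + 1)) % N = j → S i = 0 := by
  have : NeZero N := ⟨hN.ne'⟩
  have h1 : occ (zerosOne p) S = #{j : Fin N | S j = 1 ∧ ∀ t, t < p → ∀ i : Fin N,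
      (i.val + (t + 1)) % N = j → S i = 0} := by
    rw [occ_zerosOne]
    -- Occurrences are re-indexed by the place of their final one instead of their start.
    refine card_equiv (Equiv.addRight (Fin.ofNat N p)) fun i => ?_
    simp only [mem_filter, mem_univ, true_and, Equiv.coe_addRight, mk_add_mod]
    rw [and_comm]
    refine and_congr_right fun _ => ⟨fun h t ht k hk => ?_, fun h t ht => ?_⟩
    · have h2 := h (p - 1 - t) (by omega)
      have h3 : k + Fin.ofNat N (t + 1) = i + Fin.ofNat N (p - 1 - t) + Fin.ofNat N (t + 1) := by
        rw [add_assoc]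
        ext
        rw [← mk_add_mod]
        refine hk.trans ?_
        simp only [Fin.val_add, Fin.val_ofNat, Nat.mod_add_mod, Nat.add_mod_mod]
        congr 2
        omega
      rwa [add_right_cancel h3]
    · refine h (p - 1 - t) (by omega) _ ?_
      simp only [Fin.val_add, Fin.val_ofNat, Nat.mod_add_mod, Nat.add_mod_mod]
      congr 1
      omega
  rw [h1, ones]
  constructor
  · intro h j hj
    have h2 := eq_of_subset_of_card_le
      (s := ({j : Fin N | S j = 1 ∧ ∀ t, t < p → ∀ i : Fin N,
        (i.val + (t + 1)) % N = j → S i = 0} : Finset _))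
      (t := ({j : Fin N | S j = 1} : Finset _))
      (fun x hx => mem_filter.2 ⟨mem_univ _, (mem_filter.1 hx).2.1⟩) h.ge
    have h3 : j ∈ ({j : Fin N | S j = 1} : Finset _) := mem_filter.2 ⟨mem_univ j, hj⟩
    rw [← h2] at h3
    exact (mem_filter.1 h3).2.2
  · intro h
    exact congrArg card (filter_congr fun j _ => ⟨fun h' => h'.1, fun h' => ⟨h', h j h'⟩⟩)

/-- Separation means that `p` zeros precede every one. The bound `p < N` matters for a single one:
separation is then vacuous, whereas a run of `N` zeros before that one would wrap onto it. -/
theorem separated_iff {N : ℕ} (p : ℕ) (S : Fin N → Fin 2) (hp : p < N) :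
    Separated p S ↔ occ (zerosOne p) S = ones S := by
  rw [occ_eq_ones_iff p S (by omega)]
  have key : ∀ i j : Fin N, ((i.val ≤ j.val ∧ (j.val + N - i.val) % N = j.val - i.val) ∨
      (j.val < i.val ∧ (j.val + N - i.val) % N = j.val + N - i.val)) := by
    intro i j
    rcases le_or_gt i.val j.val with h | h
    · left
      rw [show j.val + N - i.val = j.val - i.val + N by omega, Nat.add_mod_right,
        Nat.mod_eq_of_lt (by omega)]
      exact ⟨h, rfl⟩
    · exact Or.inr ⟨h, Nat.mod_eq_of_lt (by omega)⟩
  have wrap : ∀ a, a < 2 * N → (a < N ∧ a % N = a) ∨ (N ≤ a ∧ a % N = a - N) := by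
    intro a ha
    rcases lt_or_ge a N with h | h
    · exact Or.inl ⟨h, Nat.mod_eq_of_lt h⟩
    · refine Or.inr ⟨h, ?_⟩
      rw [Nat.mod_eq_sub_mod h, Nat.mod_eq_of_lt (by omega)]
  constructor
  · intro h j hj t ht i hi
    by_contra hi0
    have hi1 : S i = 1 := by
      revert hi0
      generalize S i = x
      revert x
      decide
    have hij : i ≠ j := by
      rintro rfl
      have := wrap (i.val + (t + 1)) (by omega)
      omega
    have hd : (j.val + N - i.val) % N = t + 1 := by
      have := wrap (i.val + (t + 1)) (by omega)
      have := key i j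
      omega
    have h1 := h i j hi1 hj hij
    rw [hd] at h1
    -- The starting place holds a one, so at most `t < p` of the `t + 1` places passed hold zeros.
    have h2 : #{t ∈ range (t + 1) | S ⟨(i.val + t) % N, Nat.mod_lt _ i.pos⟩ = 0} ≤
        #((range (t + 1)).erase 0) := by
      refine card_le_card fun x hx => ?_
      rw [mem_filter] at hx
      refine mem_erase.2 ⟨?_, hx.1⟩
      rintro rfl
      apply hi0
      rw [← hx.2]
      congr 1
      ext
      simp [Nat.mod_eq_of_lt i.isLt]
    rw [card_erase_of_mem (mem_range.2 (by omega)), card_range] at h2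
    omega
  · intro h i j hi hj hij
    have hij' : i.val ≠ j.val := fun h => hij (Fin.ext h)
    -- Otherwise `i` would be one of the `p` places before `j`, which hold zeros.
    have hd : p < (j.val + N - i.val) % N := by
      by_contra hcon
      have h1 := h j hj ((j.val + N - i.val) % N - 1) (by have := key i j; omega) i (by
        have := key i j
        have := wrap (i.val + ((j.val + N - i.val) % N - 1 + 1)) (by omega)
        omega)
      rw [hi] at h1
      exact absurd h1 (by decide)
    -- The last `p` places before `j` supply the required zeros.
    calc p = #(Ico ((j.val + N - i.val) % N - p) ((j.val + N - i.val) % N)) := by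
          rw [Nat.card_Ico]
          omega
      _ ≤ _ := by
          refine card_le_card fun x hx => ?_
          rw [mem_Ico] at hx
          refine mem_filter.2 ⟨mem_range.2 hx.2, ?_⟩
          refine h j hj ((j.val + N - i.val) % N - x - 1) (by omega) _ ?_
          have := key i j
          simp only [Nat.mod_add_mod]
          have := wrap (i.val + x + ((j.val + N - i.val) % N - x - 1 + 1)) (by omega)
          omega

theorem kaplansky_eq (N n p : ℕ) (h : p * n < N) :
    (kaplansky N n p : ℚ) =
      (N : ℚ) / ((N - p * n : ℕ) : ℚ) * ((N - p * n).choose n : ℚ) := by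
  have hones : ∀ S : Fin N → Fin 2, ones S ≤ N := fun S => by
    simpa [ones] using card_le_univ ({i | S i = 1} : Finset (Fin N))
  -- Without ones there is nothing to mark; the zero sequence is counted directly.
  rcases Nat.eq_zero_or_pos n with rfl | hn
  · have hN : (N : ℚ) ≠ 0 := by
      have : 0 < N := by omega
      positivity
    have : ({S : Fin N → Fin 2 | ones S = 0 ∧ Separated p S} : Finset _) = {fun _ => 0} := by
      ext S
      rw [mem_filter, mem_singleton, ones, card_eq_zero, filter_eq_empty_iff]
      constructor
      · rintro ⟨-, h, -⟩
        funext i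
        have := h (mem_univ i)
        revert this
        generalize S i = x
        revert x
        decide
      · rintro rfl
        exact ⟨mem_univ _, by simp, fun i j hi => absurd hi (by simp)⟩
    rw [kaplansky, this]
    simp [hN]
  · have hp : p < N := lt_of_le_of_lt (Nat.le_mul_of_pos_right p hn) h
    rcases lt_or_ge N n with hNn | hNn
    · rw [kaplansky, filter_false_of_mem, Nat.choose_eq_zero_of_lt (by omega)]
      · simp
      · rintro S - ⟨h1, -⟩
        have := hones S
        omega
    · obtain ⟨m, rfl⟩ := Nat.exists_eq_add_of_le' hNn
      rw [← T_full_eq m n p hn h, kaplansky, T]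
      congr 2
      refine filter_congr fun S _ => ?_
      rw [separated_iff p S hp]
      exact and_congr_right fun h => by rw [h]

end BinSeq

/-! ### Assembly -/

theorem lemmaI :
    -- the number of compositions of `m` into `h` parts that have dimension `ℓ` after
    -- deleting the first `s + 1` columns
    (∀ s m h ℓ : ℕ,
      ((#{a : Composition m | a.length = h ∧
        (BinSeq.deleteColumns (s + 1) a).length = ℓ} : ℕ) : ℚ) = BinSeq.c s m h ℓ) ∧
    -- the dimensions that occur
    (∀ s m h ℓ : ℕ, 1 ≤ ℓ →
      ((∃ a : Composition m, a.length = h ∧ (BinSeq.deleteColumns (s + 1) a).length = ℓ) ↔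
        ℓ ≤ h ∧ h + (s + 1) * ℓ ≤ m)) ∧
    (∀ s m h : ℕ,
      ((∃ a : Composition m, a.length = h ∧ (BinSeq.deleteColumns (s + 1) a).length = 0) ↔
        h ≤ m ∧ m ≤ (s + 1) * h)) ∧
    -- the second form of the numbers `c`
    (∀ s i j k : ℕ, 1 ≤ k →
      BinSeq.c s i j k = (j.choose k : ℚ) * ∑ f ∈ BinSeq.chains s j k,
        (BinSeq.nested j k f : ℚ) *
          (BinSeq.zchoose ((i : ℤ) - j - (∑ t, (f t : ℤ)) - 1) ((k : ℤ) - 1) : ℚ)) ∧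
    (∀ s i j : ℕ,
      BinSeq.c s i j 0 = if i ≤ (s + 1) * j then
        ∑ f ∈ BinSeq.chains s j 0 with j + ∑ t, f t = i, (BinSeq.nested j 0 f : ℚ) else 0) ∧
    -- joint distribution of the strings 01, 001, …, 0⋯01
    (∀ (s m n h ℓ : ℕ) (f : Fin s → ℕ), 1 ≤ n → 1 ≤ h →
      (BinSeq.jointT m n (BinSeq.ext h ℓ f) : ℚ) =
        ((m + n : ℕ) : ℚ) / h * BinSeq.cBar s m h f ℓ * ((n - 1).choose (h - 1) : ℚ)) ∧
    -- joint distribution of 01, 001, 0001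
    (∀ m n h ℓ' ℓ : ℕ, 1 ≤ n → 1 ≤ ℓ →
      (BinSeq.jointT m n ![h, ℓ', ℓ] : ℚ) =
        ((m + n : ℕ) : ℚ) / n * (h.choose ℓ : ℚ) *
          (BinSeq.zchoose ((h : ℤ) - ℓ) ((ℓ' : ℤ) - ℓ) : ℚ) *
          (BinSeq.zchoose ((m : ℤ) - h - ℓ' - 1) ((ℓ : ℤ) - 1) : ℚ) * (n.choose h : ℚ) ∧
      (BinSeq.jointT m n ![h, ℓ', ℓ] : ℚ) =
        ((m + n : ℕ) : ℚ) / n * (n.choose ℓ : ℚ) *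
          (BinSeq.zchoose ((n : ℤ) - ℓ) ((ℓ' : ℤ) - ℓ) : ℚ) *
          (BinSeq.zchoose ((n : ℤ) - ℓ') ((h : ℤ) - ℓ') : ℚ) *
          (BinSeq.zchoose ((m : ℤ) - h - ℓ' - 1) ((ℓ : ℤ) - 1) : ℚ)) ∧
    (∀ m n h : ℕ, 1 ≤ n → h ≤ m → m ≤ 2 * h →
      (BinSeq.jointT m n ![h, m - h, 0] : ℚ) =
        ((m + n : ℕ) : ℚ) / n * (n.choose (m - h) : ℚ) *
          (BinSeq.zchoose ((n : ℤ) - m + h) (2 * (h : ℤ) - m) : ℚ)) ∧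
    -- distribution of 0001
    (∀ m n ℓ : ℕ, 1 ≤ n → 1 ≤ ℓ →
      (BinSeq.T m n (BinSeq.zerosOne 3) ℓ : ℚ) =
        ((m + n : ℕ) : ℚ) / n * (n.choose ℓ : ℚ) *
          ∑ h ∈ Icc ℓ (min (m - 2 * ℓ) n), ∑ ℓ' ∈ Icc ℓ h,
            ((n - ℓ').choose (h - ℓ') : ℚ) * ((n - ℓ).choose (ℓ' - ℓ) : ℚ) *
              (BinSeq.zchoose ((m : ℤ) - h - ℓ' - 1) ((ℓ : ℤ) - 1) : ℚ)) ∧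
    (∀ m n : ℕ, 1 ≤ n →
      (BinSeq.T m n (BinSeq.zerosOne 3) 0 : ℚ) =
        ((m + n : ℕ) : ℚ) / n *
          ∑ h ∈ Icc ((m + 1) / 2) (min n m),
            (n.choose (m - h) : ℚ) * ((n + h - m).choose (2 * h - m) : ℚ)) ∧
    -- distribution of the string of `s + 2` zeros followed by a one
    (∀ s m n ℓ : ℕ, 1 ≤ n →
      (BinSeq.T m n (BinSeq.zerosOne (s + 2)) ℓ : ℚ) =
        ((m + n : ℕ) : ℚ) / n * ∑ h ∈ range (n + 1), BinSeq.c s m h ℓ * (n.choose h : ℚ)) ∧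
    (∀ s m n ℓ : ℕ, 1 ≤ n → 1 ≤ ℓ →
      (BinSeq.T m n (BinSeq.zerosOne (s + 2)) ℓ : ℚ) =
        ((m + n : ℕ) : ℚ) / n * (n.choose ℓ : ℚ) *
          ∑ h ∈ Icc ℓ (min (m - (s + 1) * ℓ) n), ∑ f ∈ BinSeq.chains s h ℓ,
            (BinSeq.nested h ℓ f : ℚ) * ((n - ℓ).choose (h - ℓ) : ℚ) *
              (BinSeq.zchoose ((m : ℤ) - h - (∑ t, (f t : ℤ)) - 1) ((ℓ : ℤ) - 1) : ℚ)) ∧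
    (∀ s m n : ℕ, 1 ≤ n →
      (BinSeq.T m n (BinSeq.zerosOne (s + 2)) 0 : ℚ) =
        ((m + n : ℕ) : ℚ) / n *
          ∑ h ∈ range (min m n + 1), ∑ f ∈ BinSeq.chains s h 0 with h + ∑ t, f t = m,
            (BinSeq.nested h 0 f : ℚ) * (n.choose h : ℚ)) ∧
    -- every one is preceded by at least `s + 2` zeros
    (∀ s m n : ℕ, 1 ≤ n →
      (BinSeq.T m n (BinSeq.zerosOne (s + 2)) n : ℚ) =
        ((m + n : ℕ) : ℚ) / n *
          (BinSeq.zchoose ((m : ℤ) - n - (s : ℤ) * n - 1) ((n : ℤ) - 1) : ℚ)) ∧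
    (∀ s m n : ℕ, 1 ≤ n → (s + 2) * n < m + n →
      (BinSeq.T m n (BinSeq.zerosOne (s + 2)) n : ℚ) =
        ((m + n : ℕ) : ℚ) / ((m + n - (s + 2) * n : ℕ) : ℚ) *
          ((m + n - (s + 2) * n).choose n : ℚ)) ∧
    -- the cyclic Kaplansky lemma
    (∀ N n p : ℕ, p * n < N →
      (BinSeq.kaplansky N n p : ℚ) =
        (N : ℚ) / ((N - p * n : ℕ) : ℚ) * ((N - p * n).choose n : ℚ)) := by
  refine ⟨?_, BinSeq.exists_deleteColumns_length_pos, BinSeq.exists_deleteColumns_length_zero,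
    BinSeq.c_eq_of_pos, BinSeq.c_zero_eq_ite, ?_, ?_, ?_, ?_, BinSeq.T_three_zero,
    BinSeq.T_eq_sum_c, BinSeq.T_eq_of_pos, BinSeq.T_zero_eq, ?_, ?_, BinSeq.kaplansky_eq⟩
  · intro s m h l
    rw [BinSeq.card_deleteColumns, BinSeq.c]
    push_cast
    refine sum_congr rfl fun f _ => ?_
    rw [BinSeq.columnCount_ext, Nat.choose_self, Nat.cast_one, one_mul]
  · intro s m n h l f hn hh
    exact BinSeq.jointT_eq_of_pos m n hn h l hh f
  · intro m n h x l hn hl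
    rw [BinSeq.jointT_three m n h x l hn hl]
    constructor
    · rw [BinSeq.choose_mul_choose_eq_zchoose h x l]
      push_cast
      ring
    -- Two trinomial revisions: `C(n, h) C(h, x)` releases `C(n, x)`, which is then revised against
    -- `C(x, l)`.
    · rw [← mul_assoc (n.choose h), BinSeq.choose_mul_choose_eq_zchoose n h x, mul_right_comm,
        BinSeq.choose_mul_choose_eq_zchoose n x l]
      push_cast
      ring
  · intro m n h hn h1 _
    exact BinSeq.jointT_three_zero m n h hn h1
  · intro m n l hn hl
    exact BinSeq.T_three_of_pos m n l hn hl
  · intro s m n hn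
    rw [BinSeq.T_full m n (s + 2) hn]
    congr 3
    push_cast
    ring
  · intro s m n hn h
    exact BinSeq.T_full_eq m n (s + 2) hn h
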